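/- Let $k$ be an arbitrary field and let $$G=\langle a,b,c,d \mid a^{-1}ba=b^2,\ b^{-1}cb=c^2,\ c^{-1}dc=d^2,\ d^{-1}ad=a^2\rangle$$ be the Higman group. All algebras below are unital associative $k$-algebras, and all actions and coactions of Hopf algebras are unital. A grading $\Gamma\colon A=\bigoplus_{g\in G}A^{(g)}$ of an algebra $A$ by a group $G$ satisfies $A^{(g)}A^{(h)}\subseteq A^{(gh)}$; its support is $\operatorname{supp}\Gamma=\{g\in G\mid A^{(g)}\neq 0\}$. A $G$-grading on $M_n(k)$ is elementary if there are $g_1,\dots,g_n\in G$ such that every matrix unit $e_{ij}$ has degree $g_ig_j^{-1}$. Gradings of $A_1$ and $A_2$ by groups $G_1$ and $G_2$ are equivalent if there is an algebra isomorphism $A_1\to A_2$ mapping each nonzero component of the first onto a component of the second. A realization of $\Gamma$ by a group $G'$ is a $G'$-grading on $A$ with the same nonzero components, with the corresponding map $\operatorname{supp}\Gamma\to G'$. A realization by a group $U$ with $\varkappa\colon\operatorname{supp}\Gamma\to U$ makes $U$ the universal group of $\Gamma$ if for every realization by a group $G'$ with $\psi\colon\operatorname{supp}\Gamma\to G'$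 there is a unique group homomorphism $\varphi\colon U\to G'$ with $\varphi\varkappa=\psi$. The $kG$-coaction of $\Gamma$ is $\rho\colon A\to A\otimes kG$, $\rho(x)=x\otimes g$ for $x\in A^{(g)}$. The cosupport of an action of a Hopf algebra $H$ on $A$ is the set of the operators on $A$ by which the elements of $H$ act; the cosupport of a coaction $\rho\colon A\to A\otimes H$, $\rho(x)=x_{(0)}\otimes x_{(1)}$, is the set of the operators $x\mapsto \lambda(x_{(1)})x_{(0)}$, $\lambda\in H^*$. Both are unital subalgebras of $\operatorname{End}_k(A)$. For a unital subalgebra $V\subseteq\operatorname{End}_k(A)$, a $V$-universal acting Hopf algebra is a Hopf algebra with an action on $A$ whose cosupport lies in $V$, through which every Hopf algebra action on $A$ with cosupport in $V$ factors by a unique homomorphism of Hopf algebras. The finite dual $H^\circ$ consists of the $\lambda\in H^*$ that vanish on a two-sided ideal of finite codimension. **Theorem.** For every $n\geqslant 14$ there exists an elementary $G$-grading $\Gamma$ on $M_n(k)$ such that: 1. $G$, with the inclusion $\operatorname{supp}\Gamma\subseteq G$, is the universal group of $\Gamma$; 2. $\Gamma$ is not equivalent to any grading by a finite group; 3. if $\rho\colon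 M_n(k)\to M_n(k)\otimes kG$ is the corresponding coaction and $V:=\operatorname{cosupp}\rho$, then a $V$-universal acting Hopf algebra exists, and the cosupport of its action $\psi$ is trivial and strictly smaller than $V$: $$\operatorname{cosupp}\psi = k\,\mathrm{id}_{M_n(k)}\subsetneqq V;$$ moreover, the set of operators $x\mapsto\lambda(x_{(1)})x_{(0)}$ with $\lambda\in(kG)^\circ$, i.e. the cosupport of the action of $(kG)^\circ$ dual to $\rho$, is also $k\,\mathrm{id}_{M_n(k)}$. -/

import Mathlib

open scoped TensorProduct

universe u v

noncomputable section

/-- The Higman relators on the generators `a, b, c, d` (in this order, indexed by `Fin 4`):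
`a⁻¹ b a = b²`, `b⁻¹ c b = c²`, `c⁻¹ d c = d²`, `d⁻¹ a d = a²`. -/
def higmanRelators : Set (FreeGroup (Fin 4)) :=
  let a := FreeGroup.of (0 : Fin 4)
  let b := FreeGroup.of (1 : Fin 4)
  let c := FreeGroup.of (2 : Fin 4)
  let d := FreeGroup.of (3 : Fin 4)
  {a⁻¹ * b * a * (b ^ 2)⁻¹, b⁻¹ * c * b * (c ^ 2)⁻¹,
    c⁻¹ * d * c * (d ^ 2)⁻¹, d⁻¹ * a * d * (a ^ 2)⁻¹}

/-- The Higman group. -/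
abbrev HigmanGroup : Type := PresentedGroup higmanRelators

open Classical in
/-- A grading of a `k`-algebra `A` by a (not necessarily abelian) group `G`: subspaces `A^(g)` with
`A = ⨁ A^(g)` and `A^(g) A^(h) ⊆ A^(gh)`. -/
structure GroupGrading (k A G : Type*) [Field k] [Ring A] [Algebra k A] [Group G] where
  component : G → Submodule k A
  isInternal : DirectSum.IsInternal component
  mul_mem : ∀ {g h : G} {x y : A},
    x ∈ component g → y ∈ component h → x * y ∈ component (g * h)

/-- A (unital) action of a Hopf algebra `H` on a unital associative algebra `A`: a left `H`-module
structure on `A` with `h (a b) = (h₁ a) (h₂ b)` and `h 1 = ε(h) 1`. The linear map `H ⊗ A → A` is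
given in curried form. -/
structure HopfAction (k A H : Type*) [Field k] [Ring A] [Algebra k A] [Ring H] [HopfAlgebra k H]
    where
  act : H →ₐ[k] Module.End k A
  act_mul : ∀ (h : H) (x y : A), act h (x * y) =
    LinearMap.mul' k A (TensorProduct.map (act.toLinearMap.flip x) (act.toLinearMap.flip y)
      (Coalgebra.comul (R := k) h))
  act_one : ∀ h : H, act h 1 = Coalgebra.counit (R := k) h • (1 : A)

/-- A (unital) coaction of a Hopf algebra `H` on a unital associative algebra `A`: a right
`H`-comodule structure `A → A ⊗ H` which is a homomorphism of unital algebras. -/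
structure HopfCoaction (k A H : Type*) [Field k] [Ring A] [Algebra k A] [Ring H] [HopfAlgebra k H]
    where
  coact : A →ₐ[k] A ⊗[k] H
  coassoc : ∀ x : A,
    TensorProduct.assoc k A H H (TensorProduct.map coact.toLinearMap LinearMap.id (coact x)) =
      TensorProduct.map LinearMap.id (Coalgebra.comul (R := k)) (coact x)
  counit : ∀ x : A,
    TensorProduct.rid k A (TensorProduct.map LinearMap.id (Coalgebra.counit (R := k)) (coact x)) = x

namespace HopfAction

variable {k A H : Type*} [Field k] [Ring A] [Algebra k A] [Ring H] [HopfAlgebra k H]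

/-- The cosupport of an action: the algebra of all operators by which elements of `H` act. -/
def cosupport (ψ : HopfAction k A H) : Subalgebra k (Module.End k A) := ψ.act.range

/-- `(H, ψ)` is a `V`-universal acting Hopf algebra: the cosupport of `ψ` lies in `V`, and every
action `ψ'` of a Hopf algebra `H'` with cosupport in `V` factors through `ψ` by a unique
homomorphism of Hopf algebras `H' → H` (a bialgebra homomorphism between Hopf algebras
automatically respects the antipodes). -/
def IsUniversal {k A H : Type u} [Field k] [Ring A] [Algebra k A] [Ring H] [HopfAlgebra k H]
    (ψ : HopfAction k A H) (V : Subalgebra k (Module.End k A)) : Prop :=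
  ψ.cosupport ≤ V ∧
    ∀ (H' : Type u) [Ring H'] [HopfAlgebra k H'] (ψ' : HopfAction k A H'), ψ'.cosupport ≤ V →
      ∃! φ : H' →ₐc[k] H, ∀ (h : H') (x : A), ψ'.act h x = ψ.act (φ h) x

end HopfAction

/-- The finite (Sweedler) dual of an algebra: linear functions vanishing on a two-sided ideal of
finite codimension. -/
def finiteDual (k H : Type*) [Field k] [Ring H] [Algebra k H] : Set (Module.Dual k H) :=
  {f | ∃ I : Ideal H, I.IsTwoSided ∧ FiniteDimensional k (H ⧸ I) ∧ ∀ x ∈ I, f x = 0}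

namespace HopfCoaction

variable {k A H : Type*} [Field k] [Ring A] [Algebra k A] [Ring H] [HopfAlgebra k H]

/-- The operator `a ↦ a₀ f(a₁)` on `A` defined by a linear function `f` on `H`. -/
def dualAct (ρ : HopfCoaction k A H) (f : Module.Dual k H) : Module.End k A :=
  (TensorProduct.rid k A).toLinearMap ∘ₗ TensorProduct.map LinearMap.id f ∘ₗ ρ.coact.toLinearMap

theorem dualAct_apply (ρ : HopfCoaction k A H) (f : Module.Dual k H) (x : A) :
    ρ.dualAct f x = TensorProduct.rid k A (TensorProduct.map LinearMap.id f (ρ.coact x)) := rfl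

theorem dualAct_add (ρ : HopfCoaction k A H) (f g : Module.Dual k H) :
    ρ.dualAct (f + g) = ρ.dualAct f + ρ.dualAct g := by
  ext x
  simp [dualAct_apply, TensorProduct.map_add_right]

theorem dualAct_smul (ρ : HopfCoaction k A H) (c : k) (f : Module.Dual k H) :
    ρ.dualAct (c • f) = c • ρ.dualAct f := by
  ext x
  simp [dualAct_apply, TensorProduct.map_smul_right]

theorem dualAct_counit (ρ : HopfCoaction k A H) :
    ρ.dualAct (Coalgebra.counit (R := k)) = 1 := by
  ext x
  simpa [dualAct_apply] using ρ.counit x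

theorem dualAct_mul (ρ : HopfCoaction k A H) (f g : Module.Dual k H) :
    ρ.dualAct f * ρ.dualAct g = ρ.dualAct
      ((TensorProduct.rid k k).toLinearMap ∘ₗ TensorProduct.map f g ∘ₗ
        Coalgebra.comul (R := k)) := by
  have key : ∀ t : A ⊗[k] H,
      ρ.dualAct f (TensorProduct.rid k A (TensorProduct.map LinearMap.id g t)) =
      TensorProduct.rid k A (TensorProduct.map LinearMap.id
        ((TensorProduct.rid k k).toLinearMap ∘ₗ TensorProduct.map f g)
        (TensorProduct.assoc k A H H
          (TensorProduct.map ρ.coact.toLinearMap LinearMap.id t))) := by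
    intro t
    induction t with
    | zero => simp
    | add s t hs ht => simp only [map_add, hs, ht]
    | tmul x h =>
      simp only [TensorProduct.map_tmul, LinearMap.id_apply, TensorProduct.rid_tmul, map_smul,
        dualAct_apply, AlgHom.toLinearMap_apply]
      generalize ρ.coact x = s
      induction s with
      | zero => simp
      | add s t hs ht => simp only [map_add, smul_add, TensorProduct.add_tmul, hs, ht]
      | tmul y h' => simp [mul_smul]
  ext x
  rw [Module.End.mul_apply, dualAct_apply ρ g, key, ρ.coassoc, dualAct_apply]
  congr 1
  rw [← LinearMap.comp_apply, ← TensorProduct.map_comp]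
  rfl

/-- The cosupport of a coaction: the algebra of all operators `a ↦ a₀ f(a₁)`, `f ∈ H^*`. -/
def cosupport (ρ : HopfCoaction k A H) : Subalgebra k (Module.End k A) where
  carrier := Set.range ρ.dualAct
  mul_mem' := by
    rintro _ _ ⟨f, rfl⟩ ⟨g, rfl⟩
    exact ⟨_, (ρ.dualAct_mul f g).symm⟩
  add_mem' := by
    rintro _ _ ⟨f, rfl⟩ ⟨g, rfl⟩
    exact ⟨_, ρ.dualAct_add f g⟩
  algebraMap_mem' c := by
    refine ⟨c • Coalgebra.counit (R := k), ?_⟩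
    rw [dualAct_smul, dualAct_counit, Algebra.algebraMap_eq_smul_one]

/-- The cosupport of the action of the finite dual of `H` which is dual to `ρ`. -/
def dualCosupport (ρ : HopfCoaction k A H) : Set (Module.End k A) :=
  ρ.dualAct '' finiteDual k H

end HopfCoaction

namespace GroupGrading

section

variable {k A G : Type*} [Field k] [Ring A] [Algebra k A] [Group G]

/-- The support of a grading. -/
def support (Γ : GroupGrading k A G) : Set G := {g | Γ.component g ≠ ⊥}

/-- Equivalence of gradings: an algebra isomorphism which maps every nonzero component onto some
component. -/
def Equivalent {A' G' : Type*} [Ring A'] [Algebra k A'] [Group G']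
    (Γ : GroupGrading k A G) (Γ' : GroupGrading k A' G') : Prop :=
  ∃ φ : A ≃ₐ[k] A', ∀ g ∈ Γ.support, ∃ g' : G',
    (Γ.component g).map φ.toLinearMap = Γ'.component g'

/-- `Γ'`, with the map `ψ` of the support, is a realization of the grading `Γ` as a
`G'`-grading on the same algebra. -/
def IsRealization {G' : Type*} [Group G'] (Γ : GroupGrading k A G) (Γ' : GroupGrading k A G')
    (ψ : Γ.support → G') : Prop :=
  ∀ s : Γ.support, Γ'.component (ψ s) = Γ.component s

/-- `(U, κ)` is the universal group of the grading `Γ` (tested on groups in an arbitrary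
universe `v`). -/
def IsUniversalGroup {U : Type*} [Group U] (Γ : GroupGrading k A G) (κ : Γ.support → U) : Prop :=
  (∃ Γ₀ : GroupGrading k A U, Γ.IsRealization Γ₀ κ) ∧
    ∀ (G' : Type v) [Group G'] (Γ' : GroupGrading k A G') (ψ : Γ.support → G'),
      Γ.IsRealization Γ' ψ → ∃! φ : U →* G', ∀ s, φ (κ s) = ψ s

/-- A grading on the full matrix algebra is elementary if there are `g₁, …, gₙ` in the group such
that the matrix unit `e i j` has degree `g i * (g j)⁻¹` for all `i, j`. -/
def IsElementary {n : ℕ} (Γ : GroupGrading k (Matrix (Fin n) (Fin n) k) G) : Prop :=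
  ∃ g : Fin n → G, ∀ i j, Matrix.single i j (1 : k) ∈ Γ.component (g i * (g j)⁻¹)

/-! The coaction of the group algebra that corresponds to a grading. -/

open Classical in
theorem bijective_coeLinearMap (Γ : GroupGrading k A G) :
    Function.Bijective (DirectSum.coeLinearMap Γ.component) := Γ.isInternal

open Classical in
/-- The linear map `A → A ⊗ kG` with `a ↦ a ⊗ g` for `a` in the component of degree `g`. -/
def coactLinear (Γ : GroupGrading k A G) : A →ₗ[k] A ⊗[k] MonoidAlgebra k G :=
  DirectSum.toModule k G _ (fun g =>
      ((TensorProduct.mk k A (MonoidAlgebra k G)).flip (MonoidAlgebra.single g 1)) ∘ₗ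
        (Γ.component g).subtype) ∘ₗ
    (LinearEquiv.ofBijective _ Γ.bijective_coeLinearMap).symm.toLinearMap

theorem coactLinear_of_mem (Γ : GroupGrading k A G) {g : G} {x : A} (hx : x ∈ Γ.component g) :
    Γ.coactLinear x = x ⊗ₜ[k] MonoidAlgebra.single g (1 : k) := by
  classical
  have h : (LinearEquiv.ofBijective _ Γ.bijective_coeLinearMap).symm x =
      DirectSum.lof k G (fun i => Γ.component i) g ⟨x, hx⟩ := by
    rw [LinearEquiv.symm_apply_eq, LinearEquiv.ofBijective_apply, DirectSum.coeLinearMap_lof]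
  rw [coactLinear, LinearMap.comp_apply, LinearEquiv.coe_coe, h, DirectSum.toModule_lof]
  rfl

@[elab_as_elim]
theorem homogeneous_induction (Γ : GroupGrading k A G) {p : A → Prop} (x : A) (h0 : p 0)
    (hom : ∀ g, ∀ y ∈ Γ.component g, p y) (add : ∀ y z, p y → p z → p (y + z)) :
    p x := by
  classical
  have hx : x ∈ iSup Γ.component := by
    rw [Γ.isInternal.submodule_iSup_eq_top]; trivial
  exact Submodule.iSup_induction (motive := p) Γ.component hx hom h0 add

/-- The projection onto the component of degree `g`. -/
def proj (Γ : GroupGrading k A G) (g : G) : A →ₗ[k] A :=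
  (TensorProduct.rid k A).toLinearMap ∘ₗ TensorProduct.map LinearMap.id
    (Finsupp.lapply g ∘ₗ (MonoidAlgebra.coeffLinearEquiv k).toLinearMap) ∘ₗ Γ.coactLinear

theorem proj_same (Γ : GroupGrading k A G) {g : G} {x : A} (hx : x ∈ Γ.component g) :
    Γ.proj g x = x := by
  simp [proj, Γ.coactLinear_of_mem hx]

theorem proj_ne (Γ : GroupGrading k A G) {g h : G} {x : A} (hx : x ∈ Γ.component g)
    (hgh : g ≠ h) : Γ.proj h x = 0 := by
  simp [proj, Γ.coactLinear_of_mem hx, hgh]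

theorem one_mem (Γ : GroupGrading k A G) : (1 : A) ∈ Γ.component 1 := by
  have h1 : ∀ h, ∀ y ∈ Γ.component h, ∀ x, Γ.proj h (x * y) = Γ.proj 1 x * y := by
    intro h y hy x
    refine Γ.homogeneous_induction x (by simp) ?_ ?_
    · intro g z hz
      by_cases hg : g = 1
      · subst hg
        have := Γ.mul_mem hz hy
        rw [one_mul] at this
        rw [Γ.proj_same this, Γ.proj_same hz]
      · rw [Γ.proj_ne (Γ.mul_mem hz hy) (by simpa using hg), Γ.proj_ne hz hg, zero_mul]
    · intro a b ha hb
      rw [add_mul, map_add, ha, hb, map_add, add_mul]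
  have h2 : ∀ y, Γ.proj 1 1 * y = y := by
    intro y
    refine Γ.homogeneous_induction y (by simp) ?_ ?_
    · intro g z hz
      rw [← h1 g z hz, one_mul, Γ.proj_same hz]
    · intro a b ha hb
      rw [mul_add, ha, hb]
  have h3 : ∀ x, Γ.proj 1 x ∈ Γ.component 1 := by
    intro x
    refine Γ.homogeneous_induction x (by simp) ?_ ?_
    · intro g z hz
      by_cases hg : g = 1
      · subst hg; rwa [Γ.proj_same hz]
      · rw [Γ.proj_ne hz hg]; exact zero_mem _
    · intro a b ha hb
      rw [map_add]; exact add_mem ha hb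
  have h4 := h2 1
  rw [mul_one] at h4
  rw [← h4]
  exact h3 1

/-- The coaction of the group algebra `kG` that corresponds to a `G`-grading:
`a ↦ a ⊗ g` for `a` in the component of degree `g`. -/
def coaction (Γ : GroupGrading k A G) : HopfCoaction k A (MonoidAlgebra k G) where
  coact := AlgHom.ofLinearMap Γ.coactLinear
    (by rw [Γ.coactLinear_of_mem Γ.one_mem]; rfl)
    (by
      intro x y
      refine Γ.homogeneous_induction x (by simp) ?_ ?_
      · intro g a ha
        refine Γ.homogeneous_induction y (by simp) ?_ ?_
        · intro h b hb
          rw [Γ.coactLinear_of_mem ha, Γ.coactLinear_of_mem hb,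
            Γ.coactLinear_of_mem (Γ.mul_mem ha hb)]
          simp
        · intro b c hb hc
          rw [mul_add, map_add, hb, hc, map_add, mul_add]
      · intro b c hb hc
        rw [add_mul, map_add, hb, hc, map_add, add_mul])
  coassoc x := by
    refine Γ.homogeneous_induction x (by simp) ?_ ?_
    · intro g a ha
      simp [Γ.coactLinear_of_mem ha]
    · intro b c hb hc
      simp only [map_add, hb, hc]
  counit x := by
    refine Γ.homogeneous_induction x (by simp) ?_ ?_
    · intro g a ha
      simp [Γ.coactLinear_of_mem ha]
    · intro b c hb hc
      simp only [map_add, hb, hc]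

theorem coaction_of_mem (Γ : GroupGrading k A G) {g : G} {x : A} (hx : x ∈ Γ.component g) :
    Γ.coaction.coact x = x ⊗ₜ[k] MonoidAlgebra.single g (1 : k) :=
  Γ.coactLinear_of_mem hx

end

end GroupGrading

end

/-!
The Higman group `G` has no nontrivial representations on finite dimensional vector spaces
(`HigmanGroup.representation_eq_one`): it has no nontrivial finite quotients by Higman's argument
on least prime divisors of orders (`HigmanGroup.hom_finite_eq_one`), and the matrices of a
representation have entries in a finitely generated domain, which embeds into a product of finite
fields (`eq_zero_of_forall_maximal`). On the other hand `a ≠ 1` in `G`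
(`HigmanGroup.gen_zero_ne_one`), since `G` maps to an amalgamated product in which the image of `a`
has infinite order.

The grading is the elementary one whose degrees run through the thirteen elements
`1, a, b, c, d, a², b², c², d², ba, cb, dc, ad`, some of them possibly repeated. The coincidences
among their quotients contain the defining relations of `G`, so that each multiplicative assignment
of elements of a group `M` to the matrix units which is constant on homogeneous components comes
from a homomorphism `G → M` (`HigmanGroup.exists_hom_of_cocycle`). Applied to regradings, this
yields the universal group; a regrading by a finite group would come from a trivial homomorphism,
although the component of degree `a` is different from that of degree `1`.

If a Hopf algebra `H` acts by operators which are scalar on components, then the scalars define a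
homomorphism `φ` from `G` to the units of the convolution algebra `H^*`. For `h ∈ H` the
translates of the function `g ↦ φ(g)(h)` span a finite dimensional representation of `G`, so that
this function is constant and `H` acts by its counit
(`HigmanGroup.hom_convolution_units_eq_one`, `GroupGrading.act_eq_counit`). Hence the universal
acting Hopf algebra is the ground field. Similarly, `G` acts trivially on `kG / I` for each ideal
`I` of finite codimension, so that elements of the finite dual are constant on `G`
(`HigmanGroup.finiteDual_single`). Finally, the projection onto the component of degree `1` belongs
to the cosupport of the coaction and is not scalar.
-/

/-! ### The Higman group -/

namespace HigmanGroup

/-- The generators `a, b, c, d` of the Higman group, indexed by `Fin 4`. -/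
def gen (i : Fin 4) : HigmanGroup := PresentedGroup.of i

/-- The four relators uniformly: the indices are read modulo `4`. -/
theorem relators_eq_range : higmanRelators = Set.range fun i : Fin 4 =>
    (FreeGroup.of i)⁻¹ * FreeGroup.of (i + 1) * FreeGroup.of i * (FreeGroup.of (i + 1) ^ 2)⁻¹ := by
  ext x
  simp only [higmanRelators, Set.mem_insert_iff, Set.mem_singleton_iff, Set.mem_range,
    Fin.exists_fin_succ]
  simp [eq_comm]

theorem gen_rel (i : Fin 4) : (gen i)⁻¹ * gen (i + 1) * gen i = gen (i + 1) ^ 2 := by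
  have h := PresentedGroup.mk_eq_mk_of_mul_inv_mem (rels := higmanRelators)
    (x := (FreeGroup.of i)⁻¹ * FreeGroup.of (i + 1) * FreeGroup.of i)
    (y := FreeGroup.of (i + 1) ^ 2) (by rw [relators_eq_range]; exact ⟨i, rfl⟩)
  rw [map_mul, map_mul, map_inv, map_pow] at h
  exact h

theorem exists_lift {M : Type*} [Group M] (f : Fin 4 → M)
    (h : ∀ i, (f i)⁻¹ * f (i + 1) * f i = f (i + 1) ^ 2) :
    ∃ φ : HigmanGroup →* M, ∀ i, φ (gen i) = f i := by
  refine ⟨PresentedGroup.toGroup (f := f) ?_, fun i => PresentedGroup.toGroup.of _⟩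
  rw [relators_eq_range]
  rintro _ ⟨i, rfl⟩
  simp [h i]

theorem hom_ext {M : Type*} [Group M] {φ ψ : HigmanGroup →* M}
    (h : ∀ i, φ (gen i) = ψ (gen i)) : φ = ψ :=
  PresentedGroup.ext h

end HigmanGroup

/-! ### Nontriviality of the Higman group -/

open Monoid in
/-- If each `f i : N i →* G i` is injective and its image meets the amalgamated subgroup trivially,
then the free product of the `N i` embeds into the amalgamated product of the `G i`: reduced words
are mapped to reduced words. -/
theorem Monoid.PushoutI.lift_of_comp_injective {ι : Type*} {G N : ι → Type*} {H : Type*}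
    [∀ i, Group (G i)] [∀ i, Group (N i)] [Group H] {φ : ∀ i, H →* G i}
    (hφ : ∀ i, Function.Injective (φ i)) (f : ∀ i, N i →* G i)
    (hf : ∀ i x, f i x ∈ (φ i).range → x = 1) :
    Function.Injective (CoprodI.lift fun i => (PushoutI.of (φ := φ) i).comp (f i)) := by
  classical
  rw [injective_iff_map_eq_one]
  intro x hx
  obtain ⟨w, rfl⟩ := (CoprodI.Word.equiv (M := N)).symm.surjective x
  let w' : CoprodI.Word G :=
    { toList := w.toList.map fun l => ⟨l.1, f l.1 l.2⟩
      ne_one := by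
        simp only [List.mem_map, forall_exists_index, and_imp]
        rintro _ l hl rfl h
        exact w.ne_one l hl (hf _ _ ((show f l.1 l.2 = 1 from h) ▸ one_mem _))
      chain_ne := by
        rw [List.isChain_map]
        exact w.chain_ne }
  have hw' : PushoutI.Reduced φ w' := by
    simp only [PushoutI.Reduced, w', List.mem_map, forall_exists_index, and_imp]
    rintro _ l hl rfl h
    exact w.ne_one l hl (hf _ _ h)
  have hprod : PushoutI.ofCoprodI (φ := φ) w'.prod =
      CoprodI.lift (fun i => (PushoutI.of (φ := φ) i).comp (f i)) w.prod := by
    simp [CoprodI.Word.prod, w', map_list_prod, Function.comp_def]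
  have hempty := hw'.eq_empty_of_mem_range hφ (by
    rw [hprod]
    exact (show CoprodI.lift (fun i => (PushoutI.of (φ := φ) i).comp (f i)) w.prod = 1 from hx) ▸
      one_mem _)
  have : w.toList = [] := by
    simpa [w', CoprodI.Word.empty] using congrArg CoprodI.Word.toList hempty
  change w.prod = 1
  simp [CoprodI.Word.prod, this]

namespace HigmanGroup

open Monoid

/-- The translation `x ↦ x + 1` of `ℚ`. -/
def translation : Equiv.Perm ℚ := Equiv.addRight 1

/-- The halving `x ↦ x / 2` of `ℚ`. -/
def halving : Equiv.Perm ℚ := MulAction.toPermHom ℚˣ ℚ (Units.mk0 2⁻¹ (by norm_num))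

theorem halving_conj : halving⁻¹ * translation * halving = translation ^ 2 := by
  ext x
  simp [halving, translation, pow_two, Units.smul_def]
  ring

theorem translation_zpow (n : ℤ) (x : ℚ) : (translation ^ n) x = x + n := by
  simp [translation]

theorem halving_zpow (n : ℤ) (x : ℚ) : (halving ^ n) x = 2⁻¹ ^ n * x := by
  rw [halving, ← map_zpow]
  simp [Units.smul_def]

/-- The cyclic groups generated by the translation and by the halving are infinite and meet
trivially. -/
theorem translation_zpow_eq_halving_zpow {m n : ℤ} (h : translation ^ m = halving ^ n) :
    m = 0 ∧ n = 0 := by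
  have h0 := DFunLike.congr_fun h 0
  have h1 := DFunLike.congr_fun h 1
  simp only [translation_zpow, halving_zpow, zero_add, mul_zero, Int.cast_eq_zero] at h0 h1
  subst h0
  refine ⟨rfl, zpow_right_injective₀ (a := (2⁻¹ : ℚ)) (by norm_num) (by norm_num) ?_⟩
  simpa using h1.symm

/-- One of the two permutations `x + 1` (for `false`) and `x / 2` (for `true`) of `ℚ`. -/
def affine (i : Bool) : Equiv.Perm ℚ := if i then halving else translation

theorem affine_zpow_mem_range {i : Bool} {n : Multiplicative ℤ}
    (h : zpowersHom _ (affine !i) n ∈ (zpowersHom _ (affine i)).range) : n = 1 := by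
  obtain ⟨m, hm⟩ := h
  cases i
  · exact (translation_zpow_eq_halving_zpow hm).2
  · exact (translation_zpow_eq_halving_zpow hm.symm).1

theorem affine_zpow_injective (i : Bool) : Function.Injective (zpowersHom _ (affine i)) := by
  rw [injective_iff_map_eq_one]
  intro n hn
  rw [← Bool.not_not i] at hn
  exact affine_zpow_mem_range (hn ▸ one_mem _)

/-- Two copies of the permutation group of `ℚ`, amalgamated along the infinite cyclic group which
is generated by the translation `x + 1` in the first copy and by the halving `x / 2` in the second
one. -/
abbrev Affine₂ : Type := PushoutI fun i : Bool => zpowersHom (Equiv.Perm ℚ) (affine i)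

/-- The free product of two infinite cyclic groups. -/
abbrev Free₂ : Type := CoprodI fun _ : Bool => Multiplicative ℤ

/-- The homomorphism which maps the two free generators to the halving of the first copy and the
translation of the second copy. -/
def freeHom : Free₂ →* Affine₂ :=
  CoprodI.lift fun i => (PushoutI.of i).comp (zpowersHom _ (affine !i))

theorem freeHom_injective : Function.Injective freeHom :=
  PushoutI.lift_of_comp_injective affine_zpow_injective _ fun _ _ => affine_zpow_mem_range

/-- The exchange of the two free generators. -/
def freeSwap : Free₂ →* Free₂ := CoprodI.lift fun i =>
  CoprodI.of (M := fun _ : Bool => Multiplicative ℤ) (i := !i)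

theorem freeSwap_freeSwap (x : Free₂) : freeSwap (freeSwap x) = x := by
  have : freeSwap.comp freeSwap = MonoidHom.id Free₂ := by
    apply CoprodI.ext_hom
    intro i
    ext
    cases i <;> simp [freeSwap]
  exact DFunLike.congr_fun this x

/-- Two embeddings of the free group of rank two, with the roles of its generators exchanged. Gluing
along them identifies `a, c` of the first copy with `c, a` of the second one. -/
def freeEmb (i : Bool) : Free₂ →* Affine₂ := if i then freeHom.comp freeSwap else freeHom

theorem freeEmb_injective (i : Bool) : Function.Injective (freeEmb i) := by
  cases i
  · exact freeHom_injective
  · exact freeHom_injective.comp (Function.LeftInverse.injective freeSwap_freeSwap)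

/-- Three elements of `Affine₂`, each of which squares the next one by conjugation. -/
def letter (j : Fin 3) : Affine₂ :=
  ![PushoutI.of false halving, PushoutI.of false translation, PushoutI.of true translation] j

theorem letter_rel : (letter 0)⁻¹ * letter 1 * letter 0 = letter 1 ^ 2 ∧
    (letter 1)⁻¹ * letter 2 * letter 1 = letter 2 ^ 2 := by
  -- the middle letter is the amalgamated one
  have h : letter 1 = PushoutI.of true halving := by
    have h0 := PushoutI.of_apply_eq_base (fun i : Bool => zpowersHom (Equiv.Perm ℚ) (affine i))
      false (Multiplicative.ofAdd 1)
    have h1 := PushoutI.of_apply_eq_base (fun i : Bool => zpowersHom (Equiv.Perm ℚ) (affine i))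
      true (Multiplicative.ofAdd 1)
    have h2 := h0.trans h1.symm
    simp only [affine, zpowersHom_apply, toAdd_ofAdd, zpow_one] at h2
    exact h2
  constructor
  · simp [letter, ← map_inv, ← map_mul, halving_conj, ← map_pow]
  · rw [h]
    simp [letter, ← map_inv, ← map_mul, halving_conj, ← map_pow]

/-- The free generators of `Free₂`. -/
def freeGen (i : Bool) : Free₂ := CoprodI.of (i := i) (Multiplicative.ofAdd 1)

theorem freeHom_freeGen_false : freeHom (freeGen false) = letter 0 := by
  rw [freeHom, freeGen, CoprodI.lift_of]
  exact congrArg (PushoutI.of false) (zpow_one halving)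

theorem freeHom_freeGen_true : freeHom (freeGen true) = letter 2 := by
  rw [freeHom, freeGen, CoprodI.lift_of]
  exact congrArg (PushoutI.of true) (zpow_one translation)

/-- The element `a` of the Higman group is nontrivial: the Higman group maps to the amalgamated
product of two copies of `Affine₂` along the free subgroups on the outer letters. -/
theorem gen_zero_ne_one : gen 0 ≠ 1 := by
  let ν : Bool → Affine₂ →* PushoutI freeEmb := fun i =>
    PushoutI.of (G := fun _ : Bool => Affine₂) i
  have hν (i : Bool) : Function.Injective (ν i) := PushoutI.of_injective freeEmb_injective i
  have hglue (x : Free₂) : ν false (freeHom x) = ν true (freeHom (freeSwap x)) :=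
    (PushoutI.of_apply_eq_base freeEmb false x).trans
      (PushoutI.of_apply_eq_base freeEmb true x).symm
  have h02 : ν false (letter 0) = ν true (letter 2) := by
    rw [← freeHom_freeGen_false, ← freeHom_freeGen_true, hglue]
    simp [freeSwap, freeGen]
  have h20 : ν false (letter 2) = ν true (letter 0) := by
    rw [← freeHom_freeGen_false, ← freeHom_freeGen_true, hglue]
    simp [freeSwap, freeGen]
  have h1 (i : Bool) := congrArg (ν i) letter_rel.1
  have h2 (i : Bool) := congrArg (ν i) letter_rel.2
  simp only [map_mul, map_inv, map_pow] at h1 h2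
  obtain ⟨φ, hφ⟩ := exists_lift
    ![ν false (letter 0), ν false (letter 1), ν false (letter 2), ν true (letter 1)] (by
      intro i
      fin_cases i
      · exact h1 false
      · exact h2 false
      · have := h1 true
        rw [← h20] at this
        exact this
      · have := h2 true
        rw [← h02] at this
        exact this)
  intro h
  have h3 : ν false (letter 0) = 1 := by simpa [h] using (hφ 0).symm
  rw [← map_one (ν false), (hν false).eq_iff, ← map_one (PushoutI.of false),
    letter, Matrix.cons_val_zero,
    (PushoutI.of_injective affine_zpow_injective false).eq_iff] at h3
  have := translation_zpow_eq_halving_zpow (m := 0) (n := 1) (by simp [h3])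
  simp at this

end HigmanGroup

/-! ### Finite quotients and finite dimensional representations -/

/-- If `x⁻¹ y x = y²` in a finite group and `y ≠ 1`, then the least prime divisor `p` of the order
of `y` is odd, and the order of `2` modulo `p` is a divisor of the order of `x`. -/
theorem minFac_orderOf_lt_of_conj_eq_sq {Q : Type*} [Group Q] [Finite Q] {x y : Q}
    (h : x⁻¹ * y * x = y ^ 2) (hy : y ≠ 1) :
    x ≠ 1 ∧ (orderOf x).minFac < (orderOf y).minFac := by
  have hpow (m : ℕ) : (x ^ m)⁻¹ * y * x ^ m = y ^ 2 ^ m := by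
    induction m with
    | zero => simp
    | succ m ih =>
      calc (x ^ (m + 1))⁻¹ * y * x ^ (m + 1) = x⁻¹ * ((x ^ m)⁻¹ * y * x ^ m) * x := by
            rw [pow_succ]; group
        _ = (x⁻¹ * y * x) ^ 2 ^ m := by
            rw [ih]; simpa using (conj_pow (a := x⁻¹) (b := y) (i := 2 ^ m)).symm
        _ = y ^ 2 ^ (m + 1) := by rw [h, ← pow_mul, pow_succ']
  have hdvd : orderOf y ∣ 2 ^ orderOf x - 1 := by
    refine orderOf_dvd_of_pow_eq_one ?_
    have := hpow (orderOf x)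
    rw [pow_orderOf_eq_one] at this
    have h1 : y ^ (2 ^ orderOf x - 1) * y = y := by
      rw [← pow_succ, Nat.sub_add_cancel Nat.one_le_two_pow, ← this]; group
    simpa using h1
  have hp : (orderOf y).minFac.Prime := Nat.minFac_prime (by simpa using hy)
  set p := (orderOf y).minFac with hpdef
  have : Fact p.Prime := ⟨hp⟩
  have h2 : (2 : ZMod p) ^ orderOf x = 1 := by
    have h3 := (ZMod.natCast_eq_zero_iff _ _).2 ((Nat.minFac_dvd (orderOf y)).trans hdvd)
    rw [Nat.cast_sub Nat.one_le_two_pow] at h3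
    simpa [sub_eq_zero] using h3
  have h20 : (2 : ZMod p) ≠ 0 := by
    rintro h0
    rw [h0, zero_pow (orderOf_pos x).ne'] at h2
    exact zero_ne_one h2
  have h21 : orderOf (2 : ZMod p) ≠ 1 := by
    rw [Ne, orderOf_eq_one_iff]
    intro h
    have : (2 : ZMod p) = 1 + 1 := by norm_num
    rw [this] at h
    simp at h
  have hx : orderOf (2 : ZMod p) ∣ orderOf x := orderOf_dvd_of_pow_eq_one h2
  have hp1 : orderOf (2 : ZMod p) ∣ p - 1 :=
    orderOf_dvd_of_pow_eq_one (ZMod.pow_card_sub_one_eq_one h20)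
  have hlt : orderOf (2 : ZMod p) < p :=
    (Nat.le_of_dvd (Nat.sub_pos_of_lt hp.one_lt) hp1).trans_lt (Nat.sub_lt hp.pos one_pos)
  refine ⟨?_, ?_⟩
  · rintro rfl
    simp at hx
    exact h21 (by simpa using hx)
  · have hq := Nat.minFac_prime h21
    exact (Nat.minFac_le_of_dvd hq.two_le ((Nat.minFac_dvd _).trans hx)).trans_lt
      ((Nat.minFac_le (orderOf_pos_iff.2 (isOfFinOrder_iff_pow_eq_one.2
        ⟨p - 1, Nat.sub_pos_of_lt hp.one_lt, ZMod.pow_card_sub_one_eq_one h20⟩))).trans_lt hlt)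

namespace HigmanGroup

/-- The Higman group has no nontrivial finite quotients: the least prime divisors of the orders of
the images of the generators would decrease strictly around a cycle. -/
theorem hom_finite_eq_one {Q : Type*} [Group Q] [Finite Q] (φ : HigmanGroup →* Q) : φ = 1 := by
  have hrel (i : Fin 4) : (φ (gen i))⁻¹ * φ (gen (i + 1)) * φ (gen i) = φ (gen (i + 1)) ^ 2 := by
    rw [← map_inv, ← map_mul, ← map_mul, gen_rel, map_pow]
  have step (i : Fin 4) := minFac_orderOf_lt_of_conj_eq_sq (hrel i)
  refine hom_ext fun i => ?_
  by_contra h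
  rw [MonoidHom.one_apply] at h
  -- four steps around the cycle lead back to the same generator
  have h4 (i : Fin 4) : i = i + 1 + 1 + 1 + 1 := by fin_cases i <;> rfl
  rw [h4 i] at h
  have s1 := step _ h
  have s2 := step _ s1.1
  have s3 := step _ s2.1
  have s4 := step _ s3.1
  rw [← h4 i] at s1
  exact lt_irrefl _ (s4.2.trans (s3.2.trans (s2.2.trans s1.2)))

end HigmanGroup

theorem Int.isJacobsonRing : IsJacobsonRing ℤ := by
  refine isJacobsonRing_iff_prime_eq.2 fun I hI => ?_
  by_cases h0 : I = ⊥
  · subst h0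
    rw [eq_bot_iff]
    intro x hx
    rw [Ideal.mem_jacobson_bot] at hx
    rw [Ideal.mem_bot]
    -- `x * x + 1` is a unit, hence equal to `1` or `-1`
    rcases Int.isUnit_iff.1 (hx x) with h | h
    · exact mul_self_eq_zero.1 (by linarith)
    · nlinarith [mul_self_nonneg x]
  · have := hI.isMaximal h0
    exact Ideal.jacobson_eq_self_of_isMaximal

/-- A field which is finitely generated as a ring is finite. -/
theorem finite_of_field_of_finiteType_int (F : Type*) [Field F]
    (hF : (Int.castRingHom F).FiniteType) : Finite F := by
  have := Int.isJacobsonRing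
  have : Algebra.FiniteType ℤ F := RingHom.finiteType_algebraMap.1 hF
  have hfin : Module.Finite ℤ F := finite_of_finite_type_of_isJacobsonRing ℤ F
  obtain ⟨p, hp⟩ := CharP.exists F
  rcases CharP.char_is_prime_or_zero F p with h | rfl
  · have : Fact p.Prime := ⟨h⟩
    let _ : Algebra (ZMod p) F := ZMod.algebra F p
    have : Module.Finite (ZMod p) F := Module.Finite.of_restrictScalars_finite ℤ (ZMod p) F
    exact Module.finite_of_finite (ZMod p)
  · have : CharZero F := CharP.charP_to_charZero F
    have hint : Algebra.IsIntegral ℤ F := inferInstance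
    have : IsField ℤ := isField_of_isIntegral_of_isField
      (FaithfulSMul.algebraMap_injective ℤ F) (Field.toIsField F)
    exact absurd this Int.not_isField

/-- A finitely generated commutative domain embeds into the product of its finite quotient
fields. -/
theorem eq_zero_of_forall_maximal {R : Type*} [CommRing R] [IsDomain R]
    (hR : (Int.castRingHom R).FiniteType) {x : R}
    (h : ∀ m : Ideal R, m.IsMaximal → Finite (R ⧸ m) → x ∈ m) : x = 0 := by
  have := Int.isJacobsonRing
  have hJ : IsJacobsonRing R := hR.isJacobsonRing
  have h0 : (⊥ : Ideal R).jacobson = ⊥ := hJ.out Ideal.isPrime_bot.isRadical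
  rw [← Ideal.mem_bot, ← h0, Ideal.jacobson, Submodule.mem_sInf]
  intro m hm
  have := hm.2
  refine h m this ?_
  have hfin : (Int.castRingHom (R ⧸ m)).FiniteType := by
    rw [RingHom.ext_int (Int.castRingHom (R ⧸ m)) ((Ideal.Quotient.mk m).comp (Int.castRingHom R))]
    exact hR.comp_surjective Ideal.Quotient.mk_surjective
  let _ := Ideal.Quotient.field m
  exact finite_of_field_of_finiteType_int _ hfin

namespace HigmanGroup

/-- The Higman group has no nontrivial representations by matrices over a finitely generated
domain, since such matrices are separated by the reductions modulo maximal ideals. -/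
theorem hom_matrix_finiteType_eq_one {R m : Type*} [CommRing R] [IsDomain R]
    [Fintype m] [DecidableEq m] (hR : (Int.castRingHom R).FiniteType)
    (φ : HigmanGroup →* (Matrix m m R)ˣ) : φ = 1 := by
  refine MonoidHom.ext fun g => Units.ext (Matrix.ext fun i j => ?_)
  rw [MonoidHom.one_apply, ← sub_eq_zero]
  refine eq_zero_of_forall_maximal hR (fun I _ _ => ?_)
  have h := hom_finite_eq_one (Q := (Matrix m m (R ⧸ I))ˣ)
    ((Units.map (Ideal.Quotient.mk I).mapMatrix.toMonoidHom).comp φ)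
  have h2 := congrArg (fun u : (Matrix m m (R ⧸ I))ˣ => u.val i j) (DFunLike.congr_fun h g)
  rw [← Ideal.Quotient.eq_zero_iff_mem, map_sub, sub_eq_zero]
  refine h2.trans ?_
  simp [Matrix.one_apply, apply_ite]

/-- The Higman group has no nontrivial matrix representations over a field: the entries of the
matrices of the generators and of their inverses generate a finitely generated domain. -/
theorem hom_matrix_eq_one {k m : Type*} [Field k] [Fintype m] [DecidableEq m]
    (φ : HigmanGroup →* (Matrix m m k)ˣ) : φ = 1 := by
  let s : Set k := Set.range (fun t : Fin 4 × m × m => (φ (gen t.1)).1 t.2.1 t.2.2) ∪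
    Set.range (fun t : Fin 4 × m × m => (φ (gen t.1)⁻¹).1 t.2.1 t.2.2)
  have hs : s.Finite := (Set.finite_range _).union (Set.finite_range _)
  let R : Subalgebra ℤ k := Algebra.adjoin ℤ s
  have hR : (Int.castRingHom R).FiniteType := by
    rw [RingHom.ext_int (Int.castRingHom R) (algebraMap ℤ R)]
    exact RingHom.finiteType_algebraMap.2
      ((Subalgebra.fg_iff_finiteType _).1 ⟨hs.toFinset, by simp [R]⟩)
  let ι : Matrix m m R →* Matrix m m k := (algebraMap R k).mapMatrix.toMonoidHom
  have hι : Function.Injective ι := Matrix.map_injective Subtype.val_injective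
  have hι' : Function.Injective (Units.map ι) := Units.map_injective hι
  let M (i : Fin 4) : Matrix m m R := fun a b =>
    ⟨(φ (gen i)).1 a b, Algebra.subset_adjoin (Or.inl ⟨(i, a, b), rfl⟩)⟩
  let N (i : Fin 4) : Matrix m m R := fun a b =>
    ⟨(φ (gen i)⁻¹).1 a b, Algebra.subset_adjoin (Or.inr ⟨(i, a, b), rfl⟩)⟩
  have hM (i) : ι (M i) = (φ (gen i)).1 := rfl
  have hN (i) : ι (N i) = (φ (gen i)⁻¹).1 := rfl
  let U (i : Fin 4) : (Matrix m m R)ˣ :=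
    ⟨M i, N i, hι (by rw [map_mul, hM, hN, map_one, ← Units.val_mul, ← map_mul]; simp),
      hι (by rw [map_mul, hM, hN, map_one, ← Units.val_mul, ← map_mul]; simp)⟩
  have hU (i) : Units.map ι (U i) = φ (gen i) := Units.ext (hM i)
  obtain ⟨ψ, hψ⟩ := exists_lift U fun i => hι' (by
    simp only [map_mul, map_inv, map_pow, hU]
    rw [← map_inv, ← map_mul, ← map_mul, gen_rel, map_pow])
  refine hom_ext fun i => ?_
  rw [← hU, ← hψ, hom_matrix_finiteType_eq_one hR ψ]
  simp

/-- The Higman group acts trivially on every finite dimensional vector space. -/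
theorem representation_eq_one {k W : Type*} [Field k] [AddCommGroup W] [Module k W]
    [FiniteDimensional k W] (σ : Representation k HigmanGroup W) (g : HigmanGroup) : σ g = 1 := by
  let b := Module.finBasis k W
  have h := hom_matrix_eq_one ((Units.map (LinearMap.toMatrixAlgEquiv b).toMonoidHom).comp
    (MonoidHom.toHomUnits σ))
  have h2 := congrArg Units.val (DFunLike.congr_fun h g)
  apply (LinearMap.toMatrixAlgEquiv b).injective
  rw [map_one]
  exact h2

/-- A vector whose orbit under the Higman group lies in a finite dimensional subspace is fixed. -/
theorem representation_apply_eq_self {k W : Type*} [Field k] [AddCommGroup W] [Module k W]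
    (σ : Representation k HigmanGroup W) (w : W) (E : Submodule k W) [FiniteDimensional k E]
    (hE : ∀ g, σ g w ∈ E) (g : HigmanGroup) : σ g w = w := by
  let O : Submodule k W := Submodule.span k (Set.range fun g => σ g w)
  have hO : O ≤ E := Submodule.span_le.2 (by rintro _ ⟨g, rfl⟩; exact hE g)
  have : FiniteDimensional k O := Submodule.finiteDimensional_of_le hO
  have hinv (g : HigmanGroup) : ∀ x ∈ O, σ g x ∈ O := by
    have : O ≤ O.comap (σ g) := Submodule.span_le.2 (by
      rintro _ ⟨h, rfl⟩
      refine Submodule.subset_span ⟨g * h, ?_⟩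
      simp)
    exact this
  let τ : Representation k HigmanGroup O :=
    { toFun := fun g => (σ g).restrict (hinv g)
      map_one' := by ext; simp
      map_mul' := fun g h => by ext; simp }
  have hw : w ∈ O := Submodule.subset_span ⟨1, by simp⟩
  exact congrArg Subtype.val (DFunLike.congr_fun (representation_eq_one τ g) ⟨w, hw⟩)

end HigmanGroup

/-! ### Degrees that encode the Higman relations -/

namespace HigmanGroup

/-- The thirteen elements `1`, `a, b, c, d`, `a², b², c², d²`, `ba, cb, dc, ad`. The relations among
the quotients of these elements determine the Higman group. -/
def word : Option (Fin 3 × Fin 4) → HigmanGroup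
  | none => 1
  | some (0, i) => gen i
  | some (1, i) => gen i ^ 2
  | some (2, i) => gen (i + 1) * gen i

/-- A function on pairs which is multiplicative and which depends only on the quotient of the
degrees comes from a homomorphism of the Higman group. The relations are read off from the
equalities `a² / a = a / 1`, `(ba) / a = b / 1` and `(ba) / b² = a / 1` of quotients. -/
theorem exists_hom_of_cocycle {ι M : Type*} [Group M] (π : ι → Option (Fin 3 × Fin 4))
    (hπ : Function.Surjective π) (f : ι → ι → M) (hmul : ∀ i j l, f i j * f j l = f i l)
    (hdeg : ∀ i j l m, word (π i) * (word (π j))⁻¹ = word (π l) * (word (π m))⁻¹ →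
      f i j = f l m) :
    ∃ φ : HigmanGroup →* M, ∀ i j, φ (word (π i) * (word (π j))⁻¹) = f i j := by
  obtain ⟨σ, hσ⟩ := hπ.hasRightInverse
  let o := σ none
  have ho : word (π o) = 1 := by rw [hσ none]; rfl
  let x (i : Fin 4) : M := f (σ (some (0, i))) o
  have hsq (i : Fin 4) : f (σ (some (1, i))) o = x i ^ 2 := by
    rw [← hmul _ (σ (some (0, i))), pow_two]
    congr 1
    apply hdeg
    rw [hσ, hσ, ho]
    simp [word, pow_two]
  have hprod (i : Fin 4) : f (σ (some (2, i))) o = x (i + 1) * x i := by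
    rw [← hmul _ (σ (some (0, i)))]
    congr 1
    apply hdeg
    rw [hσ, hσ, hσ, ho]
    simp [word]
  have hprod' (i : Fin 4) : f (σ (some (2, i))) o = x i * x (i + 1) ^ 2 := by
    rw [← hmul _ (σ (some (1, i + 1))), hsq]
    congr 1
    apply hdeg
    rw [hσ, hσ, hσ, ho]
    simp only [word]
    rw [← gen_rel]
    group
  obtain ⟨φ, hφ⟩ := exists_lift x fun i => by
    rw [mul_assoc, ← hprod, hprod', inv_mul_cancel_left]
  have hone : f o o = 1 := by simpa using hmul o o o
  have hword (w) : φ (word w) = f (σ w) o := by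
    match w with
    | none => simpa [word] using hone.symm
    | some (0, i) => exact hφ i
    | some (1, i) => rw [hsq, ← hφ, ← map_pow]; rfl
    | some (2, i) => rw [hprod, ← hφ, ← hφ, ← map_mul]; rfl
  have hword' (i) : φ (word (π i)) = f i o := by
    rw [hword]
    apply hdeg
    rw [hσ]
  refine ⟨φ, fun i j => ?_⟩
  rw [map_mul, map_inv, hword', hword', ← hmul i o j, eq_comm]
  congr 1
  rw [eq_inv_iff_mul_eq_one, hmul, hone]

end HigmanGroup

/-! ### Elementary gradings -/

namespace GroupGrading

variable {k : Type*} [Field k]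

theorem eq_of_mem_component {A G : Type*} [Ring A] [Algebra k A] [Group G]
    (Γ : GroupGrading k A G) {g h : G} {x : A} (hg : x ∈ Γ.component g) (hh : x ∈ Γ.component h)
    (hx : x ≠ 0) : g = h := by
  by_contra hgh
  exact hx ((Γ.proj_same hh).symm.trans (Γ.proj_ne hg hgh))

section

variable {ι G : Type*} [Group G]

variable (k) in
/-- The matrices all of whose nonzero entries are at places `(i, j)` with
`d i * (d j)⁻¹ = g`. -/
def elementaryComponent (d : ι → G) (g : G) : Submodule k (Matrix ι ι k) where
  carrier := {x | ∀ i j, x i j ≠ 0 → d i * (d j)⁻¹ = g}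
  zero_mem' i j h := absurd rfl h
  add_mem' {x y} hx hy i j h := by
    by_cases hxij : x i j = 0
    · exact hy i j fun hyij => h (by simp [hxij, hyij])
    · exact hx i j hxij
  smul_mem' c x hx i j h := hx i j fun hxij => h (by simp [hxij])

theorem single_mem_elementaryComponent [DecidableEq ι] (d : ι → G) (i j : ι) (c : k) :
    Matrix.single i j c ∈ elementaryComponent k d (d i * (d j)⁻¹) := by
  intro i' j' h
  by_cases h' : i = i' ∧ j = j'
  · rw [h'.1, h'.2]
  · exact absurd (Matrix.single_apply_of_ne _ _ _ _ _ h') h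

open Classical in
theorem coeLinearMap_elementaryComponent_apply (d : ι → G)
    (x : DirectSum G fun g => elementaryComponent k d g) (i j : ι) :
    DirectSum.coeLinearMap (elementaryComponent k d) x i j =
      (x (d i * (d j)⁻¹) : Matrix ι ι k) i j := by
  induction x using DirectSum.induction_on with
  | zero => simp
  | of g y =>
    rw [DirectSum.coeLinearMap_of]
    by_cases hg : d i * (d j)⁻¹ = g
    · subst hg
      rw [DirectSum.of_eq_same]
    · rw [DirectSum.of_eq_of_ne _ _ _ hg]
      by_contra h
      exact hg (y.2 i j h)
  | add x y hx hy => simp [hx, hy]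

theorem single_one_ne_zero [DecidableEq ι] (i j : ι) : Matrix.single i j (1 : k) ≠ 0 := fun h => by
  simpa using congrFun (congrFun h i) j

variable [Fintype ι] [DecidableEq ι]

variable (k) in
/-- The elementary grading on a matrix algebra in which the matrix unit `e i j` has degree
`d i * (d j)⁻¹`. -/
def elementary (d : ι → G) : GroupGrading k (Matrix ι ι k) G where
  component := elementaryComponent k d
  isInternal := by
    classical
    constructor
    · change Function.Injective (DirectSum.coeLinearMap (elementaryComponent k d))
      rw [injective_iff_map_eq_zero]
      intro x hx
      ext g i j
      by_cases hg : d i * (d j)⁻¹ = g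
      · rw [← hg, ← coeLinearMap_elementaryComponent_apply, hx]
        rfl
      · by_contra h
        exact hg ((x g).2 i j h)
    · intro x
      change x ∈ LinearMap.range (DirectSum.coeLinearMap (elementaryComponent k d))
      rw [Matrix.matrix_eq_sum_single x]
      refine sum_mem fun i _ => sum_mem fun j _ => ?_
      exact ⟨DirectSum.of (fun g => elementaryComponent k d g) _
        ⟨_, single_mem_elementaryComponent d i j _⟩, DirectSum.coeLinearMap_of _ _ _⟩
  mul_mem {g h x y} hx hy i j hij := by
    rw [Matrix.mul_apply] at hij
    obtain ⟨l, -, hl⟩ := Finset.exists_ne_zero_of_sum_ne_zero hij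
    rw [← hx i l (left_ne_zero_of_mul hl), ← hy l j (right_ne_zero_of_mul hl)]
    group

theorem single_mem_elementary (d : ι → G) (i j : ι) (c : k) :
    Matrix.single i j c ∈ (elementary k d).component (d i * (d j)⁻¹) :=
  single_mem_elementaryComponent d i j c

theorem mem_support_elementary (d : ι → G) (i j : ι) :
    d i * (d j)⁻¹ ∈ (elementary k d).support := fun h =>
  single_one_ne_zero (k := k) i j ((Submodule.eq_bot_iff _).1 h _ (single_mem_elementary d i j 1))

theorem exists_eq_of_mem_support_elementary {d : ι → G} {g : G}
    (hg : g ∈ (elementary k d).support) : ∃ i j, d i * (d j)⁻¹ = g := by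
  obtain ⟨x, hx, hx0⟩ := Submodule.exists_mem_ne_zero_of_ne_bot hg
  by_contra! h
  refine hx0 (Matrix.ext fun i j => ?_)
  by_contra hij
  exact h i j (hx i j hij)

end

/-! ### Regradings -/

section

variable {ι : Type*} [Fintype ι] [DecidableEq ι] {π : ι → Option (Fin 3 × Fin 4)}

open HigmanGroup

/-- Every regrading, along an algebra isomorphism, of the elementary grading with the degrees
`word` is induced by a homomorphism of the Higman group. -/
theorem exists_hom_of_regrading (hπ : Function.Surjective π) {A' M : Type*} [Ring A']
    [Algebra k A'] [Group M] (Γ' : GroupGrading k A' M) (φ : Matrix ι ι k ≃ₐ[k] A')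
    (ψ : (elementary k (word ∘ π)).support → M)
    (hψ : ∀ s : (elementary k (word ∘ π)).support,
      ((elementary k (word ∘ π)).component s).map φ.toLinearMap = Γ'.component (ψ s)) :
    ∃ θ : HigmanGroup →* M, ∀ s : (elementary k (word ∘ π)).support, θ (s : HigmanGroup) = ψ s := by
  let f (i j : ι) : M := ψ ⟨_, mem_support_elementary (word ∘ π) i j⟩
  have hf (i j : ι) : φ (Matrix.single i j 1) ∈ Γ'.component (f i j) := by
    rw [← hψ]
    exact ⟨_, single_mem_elementary _ _ _ _, rfl⟩
  obtain ⟨θ, hθ⟩ := exists_hom_of_cocycle π hπ f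
    (fun i j l => by
      have h := Γ'.mul_mem (hf i j) (hf j l)
      rw [← map_mul, Matrix.single_mul_single_same, one_mul] at h
      refine Γ'.eq_of_mem_component h (hf i l) ?_
      rw [Ne, EmbeddingLike.map_eq_zero_iff]
      exact single_one_ne_zero i l)
    (fun i j l m h => congrArg ψ (Subtype.ext h))
  refine ⟨θ, ?_⟩
  rintro ⟨s, hs⟩
  obtain ⟨i, j, rfl⟩ := exists_eq_of_mem_support_elementary hs
  exact hθ i j

theorem gen_mem_support (hπ : Function.Surjective π) (i : Fin 4) :
    gen i ∈ (elementary k (word ∘ π)).support := by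
  obtain ⟨j, hj⟩ := hπ (some (0, i))
  obtain ⟨o, ho⟩ := hπ none
  simpa [hj, ho, word] using mem_support_elementary (k := k) (word ∘ π) j o

theorem isUniversalGroup_elementary (hπ : Function.Surjective π) :
    IsUniversalGroup.{v} (elementary k (word ∘ π)) fun s => (s : HigmanGroup) := by
  refine ⟨⟨_, fun s => rfl⟩, fun M _ Γ' ψ hψ => ?_⟩
  obtain ⟨θ, hθ⟩ := exists_hom_of_regrading hπ Γ' AlgEquiv.refl ψ fun s =>
    (Submodule.map_id _).trans (hψ s).symm
  refine ⟨θ, hθ, fun θ' hθ' => hom_ext fun i => ?_⟩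
  have h := (hθ' ⟨_, gen_mem_support hπ i⟩).trans (hθ ⟨_, gen_mem_support hπ i⟩).symm
  exact h

theorem not_equivalent_finite (hπ : Function.Surjective π) {A' M : Type*} [Ring A']
    [Algebra k A'] [Group M] [Finite M] (Γ' : GroupGrading k A' M) :
    ¬ (elementary k (word ∘ π)).Equivalent Γ' := by
  rintro ⟨φ, hφ⟩
  choose ψ hψ using fun s : (elementary k (word ∘ π)).support => hφ s s.2
  obtain ⟨θ, hθ⟩ := exists_hom_of_regrading hπ Γ' φ ψ hψ
  -- both the components of degree `1` and of degree `a` are mapped onto the component of degree `1`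
  obtain ⟨o, ho⟩ := hπ none
  have h1 : (1 : HigmanGroup) ∈ (elementary k (word ∘ π)).support := by
    simpa using mem_support_elementary (k := k) (word ∘ π) o o
  have hψ1 (s) : ψ s = 1 := by rw [← hθ, hom_finite_eq_one θ, MonoidHom.one_apply]
  have h := (hψ ⟨_, h1⟩).trans ((congrArg _ ((hψ1 _).trans (hψ1 _).symm)).trans
    (hψ ⟨_, gen_mem_support hπ 0⟩).symm)
  have h' := Submodule.map_injective_of_injective (f := φ.toLinearMap) φ.injective h
  have hmem := single_mem_elementary (k := k) (word ∘ π) o o 1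
  rw [mul_inv_cancel] at hmem
  exact gen_zero_ne_one (eq_of_mem_component _ hmem (h' ▸ hmem) (single_one_ne_zero o o)).symm

end

end GroupGrading

/-! ### Hopf algebra actions and coactions -/

open WithConv in
/-- Every homomorphism from the Higman group to the group of units of the dual algebra of a
coalgebra is trivial: for a fixed element `c` of the coalgebra, the function `g ↦ φ g c` is
a representative function of the group, i.e. its translates span a finite dimensional
space, so that it is constant. -/
theorem HigmanGroup.hom_convolution_units_eq_one {k C : Type*} [Field k] [AddCommGroup C]
    [Module k C] [Coalgebra k C] (φ : HigmanGroup →* (WithConv (C →ₗ[k] k))ˣ) : φ = 1 := by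
  refine MonoidHom.ext fun g => Units.ext (WithConv.ofConv_injective (LinearMap.ext fun c => ?_))
  -- the right regular representation on functions
  let σ : Representation k HigmanGroup (HigmanGroup → k) :=
    { toFun := fun g => LinearMap.funLeft k k (· * g)
      map_one' := by ext; simp [LinearMap.funLeft]
      map_mul' := fun g h => by ext; simp [LinearMap.funLeft, mul_assoc] }
  let F (c : C) : HigmanGroup → k := fun x => (φ x).val.ofConv c
  let 𝓡 := Coalgebra.Repr.arbitrary k c
  let E : Submodule k (HigmanGroup → k) :=
    Submodule.span k ((fun i => F (𝓡.left i)) '' (𝓡.index : Set _))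
  have : FiniteDimensional k E :=
    FiniteDimensional.span_of_finite k (𝓡.index.finite_toSet.image _)
  have hE (g : HigmanGroup) : σ g (F c) ∈ E := by
    have : σ g (F c) = ∑ i ∈ 𝓡.index, F (𝓡.right i) g • F (𝓡.left i) := by
      ext x
      change (φ (x * g)).val.ofConv c = _
      rw [map_mul, Units.val_mul]
      refine (𝓡.convMul_apply _ _).trans ?_
      simp [F, mul_comm]
    rw [this]
    exact sum_mem fun i hi => E.smul_mem _ (Submodule.subset_span ⟨i, hi, rfl⟩)
  have h := congrFun (HigmanGroup.representation_apply_eq_self σ (F c) E hE g) 1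
  change F c (1 * g) = F c 1 at h
  simpa [F] using h

namespace HopfCoaction

theorem dualAct_of_mem {k A G : Type*} [Field k] [Ring A] [Algebra k A] [Group G]
    (Γ : GroupGrading k A G) (l : Module.Dual k (MonoidAlgebra k G)) {g : G} {x : A}
    (hx : x ∈ Γ.component g) :
    Γ.coaction.dualAct l x = l (MonoidAlgebra.single g 1) • x := by
  rw [dualAct_apply, Γ.coaction_of_mem hx]
  simp

end HopfCoaction

/-- The representation of a group on a quotient of its group algebra by a left ideal. -/
noncomputable def quotientRepresentation {k G : Type*} [Field k] [Group G]
    (I : Ideal (MonoidAlgebra k G)) :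
    Representation k G (MonoidAlgebra k G ⧸ I) :=
  (Algebra.lsmul k k (MonoidAlgebra k G ⧸ I)).toMonoidHom.comp (MonoidAlgebra.of k G)

/-- An element of the finite dual of the group algebra of the Higman group takes the same value on
all group elements. -/
theorem HigmanGroup.finiteDual_single {k : Type*} [Field k]
    {l : Module.Dual k (MonoidAlgebra k HigmanGroup)} (hl : l ∈ finiteDual k _)
    (g : HigmanGroup) :
    l (MonoidAlgebra.single g 1) = l (MonoidAlgebra.single 1 1) := by
  obtain ⟨I, -, hfin, hI⟩ := hl
  have h := DFunLike.congr_fun (representation_eq_one (quotientRepresentation I) g)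
    (Submodule.Quotient.mk (1 : MonoidAlgebra k HigmanGroup))
  have h' : (Submodule.Quotient.mk (MonoidAlgebra.single g 1 * 1) :
      MonoidAlgebra k HigmanGroup ⧸ I) = Submodule.Quotient.mk 1 := h
  rw [mul_one, Submodule.Quotient.eq] at h'
  rw [← sub_eq_zero, ← map_sub]
  exact hI _ h'

theorem counit_mem_finiteDual (k H : Type*) [Field k] [Ring H] [HopfAlgebra k H] :
    (Coalgebra.counit : H →ₗ[k] k) ∈ finiteDual k H := by
  refine ⟨RingHom.ker (Bialgebra.counitAlgHom k H), inferInstance, ?_, fun x hx => hx⟩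
  let e : (H ⧸ RingHom.ker (Bialgebra.counitAlgHom k H)) →ₗ[k] k :=
    Submodule.liftQ ((RingHom.ker (Bialgebra.counitAlgHom k H)).restrictScalars k)
      (Coalgebra.counit : H →ₗ[k] k) fun x hx => hx
  refine Module.Finite.of_injective e ?_
  rw [injective_iff_map_eq_zero]
  intro x hx
  obtain ⟨x, rfl⟩ := Submodule.Quotient.mk_surjective _ x
  exact (Submodule.Quotient.mk_eq_zero _).2 hx

/-- The action of the ground field, as a Hopf algebra, on an algebra. -/
def HopfAction.ground (k A : Type*) [Field k] [Ring A] [Algebra k A] : HopfAction k A k where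
  act := Algebra.ofId k (Module.End k A)
  act_mul c x y := by simp [Algebra.ofId_apply]
  act_one c := by simp [Algebra.ofId_apply]

namespace GroupGrading

variable {k : Type*} [Field k] {ι : Type*} [Fintype ι] [DecidableEq ι]
  {π : ι → Option (Fin 3 × Fin 4)}

open HigmanGroup

section

variable {H : Type*} [Ring H] [HopfAlgebra k H]

/-- The linear function on `H` that maps `h` to the `(i, j)` entry of `h e_{ij}`, as an element of
the convolution algebra dual to `H`. If the cosupport consists of operators that are scalar on
components, then it is the eigenvalue of `h` on the matrix unit `e_{ij}`. -/
def eigenvalue (ψ : HopfAction k (Matrix ι ι k) H) (i j : ι) : WithConv (H →ₗ[k] k) :=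
  WithConv.toConv
    { toFun := fun h => ψ.act h (Matrix.single i j 1) i j
      map_add' := by simp
      map_smul' := by simp }

theorem eigenvalue_apply (ψ : HopfAction k (Matrix ι ι k) H) (i j : ι) (h : H) :
    (eigenvalue ψ i j).ofConv h = ψ.act h (Matrix.single i j 1) i j := rfl

variable {G : Type*} [Group G] {d : ι → G} {ψ : HopfAction k (Matrix ι ι k) H}

theorem exists_dual_of_cosupport_le
    (hψ : ψ.cosupport ≤ (elementary k d).coaction.cosupport) (h : H) :
    ∃ l : Module.Dual k (MonoidAlgebra k G), ∀ (g : G), ∀ x ∈ (elementary k d).component g,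
      ψ.act h x = l (MonoidAlgebra.single g 1) • x := by
  obtain ⟨l, hl⟩ := hψ ⟨h, rfl⟩
  exact ⟨l, fun g x hx => (DFunLike.congr_fun hl x).symm.trans
    (HopfCoaction.dualAct_of_mem _ l hx)⟩

theorem act_single (hψ : ψ.cosupport ≤ (elementary k d).coaction.cosupport) (i j : ι) (h : H) :
    ψ.act h (Matrix.single i j 1) = (eigenvalue ψ i j).ofConv h • Matrix.single i j 1 := by
  obtain ⟨l, hl⟩ := exists_dual_of_cosupport_le hψ h
  rw [eigenvalue_apply, hl _ _ (single_mem_elementary d i j 1)]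
  simp

theorem eigenvalue_eq_of_degree_eq (hψ : ψ.cosupport ≤ (elementary k d).coaction.cosupport)
    {i j i' j' : ι} (hd : d i * (d j)⁻¹ = d i' * (d j')⁻¹) :
    eigenvalue ψ i j = eigenvalue ψ i' j' := by
  refine WithConv.ofConv_injective (LinearMap.ext fun h => ?_)
  obtain ⟨l, hl⟩ := exists_dual_of_cosupport_le hψ h
  rw [eigenvalue_apply, eigenvalue_apply, hl _ _ (single_mem_elementary d i j 1),
    hl _ _ (single_mem_elementary d i' j' 1), hd]
  simp

theorem eigenvalue_self (hψ : ψ.cosupport ≤ (elementary k d).coaction.cosupport) (i : ι) :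
    eigenvalue ψ i i = 1 := by
  refine WithConv.ofConv_injective (LinearMap.ext fun h => ?_)
  obtain ⟨l, hl⟩ := exists_dual_of_cosupport_le hψ h
  have h1 := hl _ _ (one_mem (elementary k d))
  rw [ψ.act_one] at h1
  have h2 := congrFun (congrFun h1 i) i
  rw [eigenvalue_apply, hl _ _ (single_mem_elementary d i i 1), mul_inv_cancel]
  simpa using h2.symm

theorem eigenvalue_mul (hψ : ψ.cosupport ≤ (elementary k d).coaction.cosupport) (i j l : ι) :
    eigenvalue ψ i j * eigenvalue ψ j l = eigenvalue ψ i l := by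
  refine WithConv.ofConv_injective (LinearMap.ext fun h => ?_)
  let 𝓡 := Coalgebra.Repr.arbitrary k h
  have h1 := ψ.act_mul h (Matrix.single i j 1) (Matrix.single j l 1)
  rw [Matrix.single_mul_single_same, one_mul] at h1
  refine (𝓡.convMul_apply _ _).trans ?_
  rw [eigenvalue_apply, h1, ← 𝓡.eq]
  simp [act_single hψ, Matrix.sum_apply]

end

/-- A Hopf algebra action whose cosupport consists of operators that are scalar on the components of
the grading is trivial: the eigenvalues define a homomorphism from the Higman group to the group of
units of the dual algebra. -/
theorem act_eq_counit {H : Type*} [Ring H] [HopfAlgebra k H] {ψ : HopfAction k (Matrix ι ι k) H}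
    (hπ : Function.Surjective π)
    (hψ : ψ.cosupport ≤ (elementary k (word ∘ π)).coaction.cosupport) (h : H) :
    ψ.act h = Coalgebra.counit (R := k) h • 1 := by
  let f (i j : ι) : (WithConv (H →ₗ[k] k))ˣ :=
    ⟨eigenvalue ψ i j, eigenvalue ψ j i, by rw [eigenvalue_mul hψ, eigenvalue_self hψ],
      by rw [eigenvalue_mul hψ, eigenvalue_self hψ]⟩
  obtain ⟨φ, hφ⟩ := exists_hom_of_cocycle π hπ f
    (fun i j l => Units.ext (eigenvalue_mul hψ i j l))
    (fun i j l m hd => Units.ext (eigenvalue_eq_of_degree_eq hψ hd))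
  have hf (i j : ι) : eigenvalue ψ i j = 1 := by
    have h := hφ i j
    rw [hom_convolution_units_eq_one φ] at h
    exact (congrArg Units.val h).symm
  refine LinearMap.ext fun x => ?_
  rw [Matrix.matrix_eq_sum_single x, map_sum, map_sum]
  refine Finset.sum_congr rfl fun i _ => ?_
  rw [map_sum, map_sum]
  refine Finset.sum_congr rfl fun j _ => ?_
  rw [← mul_one (x i j), ← smul_eq_mul, ← Matrix.smul_single, map_smul, map_smul,
    act_single hψ, hf]
  rfl

theorem cosupport_eq_bot {H : Type*} [Ring H] [HopfAlgebra k H]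
    {ψ : HopfAction k (Matrix ι ι k) H} (hπ : Function.Surjective π)
    (hψ : ψ.cosupport ≤ (elementary k (word ∘ π)).coaction.cosupport) : ψ.cosupport = ⊥ := by
  rw [eq_bot_iff]
  rintro _ ⟨h, rfl⟩
  exact Algebra.mem_bot.2 ⟨_, (Algebra.algebraMap_eq_smul_one _).trans
    (act_eq_counit hπ hψ h).symm⟩

theorem isUniversal_ground {k : Type u} [Field k] {n : ℕ}
    {π : Fin n → Option (Fin 3 × Fin 4)} (hπ : Function.Surjective π) :
    (HopfAction.ground k (Matrix (Fin n) (Fin n) k)).IsUniversal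
      (elementary k (word ∘ π)).coaction.cosupport := by
  refine ⟨?_, fun H' _ _ ψ' hψ' => ⟨Bialgebra.counitBialgHom k H', fun h x => ?_, fun φ _ => ?_⟩⟩
  · rintro _ ⟨c, rfl⟩
    exact Subalgebra.algebraMap_mem _ c
  · rw [act_eq_counit hπ hψ' h]
    simp [HopfAction.ground, Algebra.ofId_apply]
  · exact Subsingleton.elim _ _

theorem dualCosupport_elementary :
    (elementary k (word ∘ π)).coaction.dualCosupport =
      Set.range fun c : k => c • LinearMap.id := by
  ext T
  constructor
  · rintro ⟨l, hl, rfl⟩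
    refine ⟨l (MonoidAlgebra.single 1 1), LinearMap.ext fun x => ?_⟩
    refine (elementary k (word ∘ π)).homogeneous_induction x (by simp) (fun g y hy => ?_)
      fun y z hy hz => by rw [map_add, map_add, hy, hz]
    rw [HopfCoaction.dualAct_of_mem _ _ hy, finiteDual_single hl g]
    rfl
  · rintro ⟨c, rfl⟩
    obtain ⟨I, hI, hfin, h⟩ := counit_mem_finiteDual k (MonoidAlgebra k HigmanGroup)
    refine ⟨c • Coalgebra.counit, ⟨I, hI, hfin, fun x hx => ?_⟩, ?_⟩
    · rw [LinearMap.smul_apply, h x hx, smul_zero]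
    · rw [HopfCoaction.dualAct_smul, HopfCoaction.dualAct_counit]
      rfl

/-- The projection onto the component of degree `1` is not scalar, because the component of degree
`a` is nonzero and `a ≠ 1`. -/
theorem bot_lt_cosupport (hπ : Function.Surjective π) :
    ⊥ < (elementary k (word ∘ π)).coaction.cosupport := by
  rw [bot_lt_iff_ne_bot]
  intro h
  let l : Module.Dual k (MonoidAlgebra k HigmanGroup) :=
    Finsupp.lapply 1 ∘ₗ (MonoidAlgebra.coeffLinearEquiv k).toLinearMap
  have hl : (elementary k (word ∘ π)).coaction.dualAct l ∈
      (elementary k (word ∘ π)).coaction.cosupport := ⟨l, rfl⟩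
  rw [h] at hl
  obtain ⟨c, hc⟩ := Algebra.mem_bot.1 hl
  obtain ⟨o, ho⟩ := hπ none
  obtain ⟨x, hx, hx0⟩ := Submodule.exists_mem_ne_zero_of_ne_bot (gen_mem_support (k := k) hπ 0)
  have h1 := DFunLike.congr_fun hc (Matrix.single o o 1)
  have hmem := single_mem_elementary (k := k) (word ∘ π) o o 1
  rw [mul_inv_cancel] at hmem
  have h2 := DFunLike.congr_fun hc x
  rw [HopfCoaction.dualAct_of_mem _ _ hmem] at h1
  rw [HopfCoaction.dualAct_of_mem _ _ hx] at h2
  have hc1 : c = 1 := by simpa [l] using congrFun (congrFun h1 o) o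
  have h3 : x = 0 := by simpa [l, hc1, gen_zero_ne_one] using h2
  exact hx0 h3

end GroupGrading

theorem mainTheorem1 (k : Type u) [Field k] (n : ℕ) (hn : 14 ≤ n) :
    ∃ Γ : GroupGrading k (Matrix (Fin n) (Fin n) k) HigmanGroup,
      Γ.IsElementary ∧
      -- the Higman group, with the inclusion of the support, is the universal group
      GroupGrading.IsUniversalGroup.{v} Γ (fun s => (s : HigmanGroup)) ∧
      -- no regrading by a finite group
      (∀ (G' : Type v) [Group G'] [Finite G'] (A' : Type u) [Ring A'] [Algebra k A']
        (Γ' : GroupGrading k A' G'), ¬ Γ.Equivalent Γ') ∧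
      -- for `V = cosupp ρ` the `V`-universal acting Hopf algebra exists and has cosupport `k · id`
      (∃ (H : Type u) (_ : Ring H) (_ : HopfAlgebra k H)
        (ψ : HopfAction k (Matrix (Fin n) (Fin n) k) H), ψ.IsUniversal Γ.coaction.cosupport) ∧
      (∀ (H : Type u) [Ring H] [HopfAlgebra k H]
        (ψ : HopfAction k (Matrix (Fin n) (Fin n) k) H),
        ψ.IsUniversal Γ.coaction.cosupport → ψ.cosupport = ⊥) ∧
      -- the action of the finite dual of `kG` dual to the coaction has cosupport `k · id`
      Γ.coaction.dualCosupport = Set.range (fun c : k => c • LinearMap.id) ∧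
      -- and `k · id` is strictly smaller than `V`
      (⊥ : Subalgebra k (Module.End k (Matrix (Fin n) (Fin n) k))) < Γ.coaction.cosupport := by
  obtain ⟨e⟩ : Nonempty (Option (Fin 3 × Fin 4) ↪ Fin n) := by
    refine Function.Embedding.nonempty_of_card_le ?_
    simp only [Fintype.card_option, Fintype.card_prod, Fintype.card_fin]
    lia
  obtain ⟨π, hπ⟩ : ∃ π : Fin n → Option (Fin 3 × Fin 4), Function.Surjective π :=
    ⟨_, Function.invFun_surjective e.injective⟩
  exact ⟨GroupGrading.elementary k (HigmanGroup.word ∘ π),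
    ⟨_, fun i j => GroupGrading.single_mem_elementary _ i j 1⟩,
    GroupGrading.isUniversalGroup_elementary hπ,
    fun G' _ _ A' _ _ Γ' => GroupGrading.not_equivalent_finite hπ Γ',
    ⟨k, _, _, _, GroupGrading.isUniversal_ground hπ⟩,
    fun H _ _ ψ hψ => GroupGrading.cosupport_eq_bot hπ hψ.1,
    GroupGrading.dualCosupport_elementary, GroupGrading.bot_lt_cosupport hπ⟩
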